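/- Let $k\ge 1$ be an integer with $3\mid k$, let $a\in\mathbb F_2$ with $a\neq 0$, and let $\mathrm{Tr}_{r/2}$ denote the trace function from $\mathbb F_r$ to $\mathbb F_2$. Put $$D=\{x\in\mathbb F_{2^k}^*:\ \mathrm{Tr}_{8/2}\big(x^{\frac{2^k-1}{7}}\big)+a=0\}=\{d_1,\dots,d_n\},$$ where $x^{(2^k-1)/7}$ is regarded as an element of $\mathbb F_8\subseteq\mathbb F_{2^k}$, and $$\mathcal C_D=\{(\mathrm{Tr}_{2^k/2}(xd_1),\dots,\mathrm{Tr}_{2^k/2}(xd_n)):\ x\in\mathbb F_{2^k}\}\subseteq\mathbb F_2^n .$$ Then, for every ordering $d_1,\dots,d_n$ of the elements of $D$, $\mathcal C_D$ is a linear code of length $n=4(2^k-1)/7$ and dimension $k$ with at most three distinct nonzero Hamming weights, and its weight distribution is as follows: the weight $0$ occurs once, and the weights $$\tfrac{2^{k+1}}{7}+\tfrac{12}{7}\mathrm{Re}\big((1+\sqrt{-7})^{\frac k3-1}\big),\qquad \tfrac{2^{k+1}}{7}-\tfrac{16}{7}\mathrm{Re}\big((1+\sqrt{-7})^{\frac k3-2}\big),\qquad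 \tfrac{2^{k+1}}{7}-\tfrac27\mathrm{Re}\big((1+\sqrt{-7})^{\frac k3}\big)$$ occur with frequencies $\frac{2^k-1}{7}$, $\frac{3(2^k-1)}{7}$ and $\frac{3(2^k-1)}{7}$, respectively; if some of these numbers coincide, their frequencies are added. -/

import Mathlib

noncomputable section

open scoped Classical

namespace TraceCode

/-- The defining set `D = {x ∈ K* : Tr_{L/F}(x ^ ((|K| - 1)/(|L| - 1))) + a = 0}` for a tower of
finite fields `F ⊆ L ⊆ K`. With `|F| = q`, `|L| = q^f`, `|K| = q^k` the exponent is
`(q^k - 1)/(q^f - 1)` (an exact division). The power lies in the image of `L` in `K`, and `y` is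
the element of `L` which it is. -/
def definingSet (F L K : Type*) [Field F] [Field L] [Field K] [Algebra F L] [Algebra L K]
    (a : F) : Set K :=
  {x : K | x ≠ 0 ∧ ∃ y : L, algebraMap L K y = x ^ ((Nat.card K - 1) / (Nat.card L - 1)) ∧
    Algebra.trace F L y + a = 0}

/-- The linear code `{(Tr_{K/F}(x d₁), …, Tr_{K/F}(x dₙ)) : x ∈ K}` in `F ^ n` given by a list
`d₁, …, dₙ` of elements of `K`. -/
def code (F : Type*) {K : Type*} [Field F] [Field K] [Algebra F K] {n : ℕ} (d : Fin n → K) :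
    Submodule F (Fin n → F) :=
  LinearMap.range (LinearMap.pi fun i => (Algebra.trace F K).comp (LinearMap.mulRight F (d i)))

/-- The number `A_w` of codewords of Hamming weight `w`. -/
def weightCount {F : Type*} [Field F] {n : ℕ} (C : Submodule F (Fin n → F)) (w : ℕ) : ℕ :=
  Set.ncard {c : Fin n → F | c ∈ C ∧ hammingNorm c = w}

/-- The set of nonzero weights of a code: those `w` with `1 ≤ w ≤ n` and `A_w ≠ 0`. -/
def nonzeroWeights {F : Type*} [Field F] {n : ℕ} (C : Submodule F (Fin n → F)) : Finset ℕ :=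
  {w ∈ Finset.Icc 1 n | weightCount C w ≠ 0}

/-- `Re((1 + √-7) ^ e)` for an integer `e`. -/
def rePow (e : ℤ) : ℝ := ((1 + (Real.sqrt 7 : ℂ) * Complex.I) ^ e).re

end TraceCode

end

/-!
For `b ≠ 0` the weight of the codeword of `b` is determined by the *period sums*
`η(u) = ∑_{x ∈ K, N(x) = u} (-1)^{Tr x}`, `u ∈ Lˣ`, where `N` is the norm from `K` to `L`: the power
map in the definition of `D` is that norm, so `D` is the union of the four fibres of `N` over the
elements of trace `1` of the field `L` of order eight, and `b * D` is again a union of four fibres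
(`TraceCode.hammingNorm_eq`).

The period sums are the coefficients of the Gauss sum over `K` of the universal multiplicative
character `Lˣ → ℝ[Lˣ]` with values in the group ring, lifted to `K` by the norm. The Davenport–Hasse
relation `DavenportHasse.davenport_hasse`, proved here for values in a commutative ring, says
that it equals `-(-G) ^ [K : L]`, where `G` is the Gauss sum over `L`. If `g` generates `Lˣ` and
`g ^ 3 + g + 1 = 0`, then `G = -1 + A - B` with `A = g + g ^ 2 + g ^ 4` and
`B = g ^ 3 + g ^ 5 + g ^ 6`. As `A` and `B` are the Gaussian periods of `ℤ/7`, the powers of `-G`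
stay in the span of `1, A, B`, and the coordinates of `(-G) ^ m` are affine functions of the real
and imaginary parts of `(1 + √-7) ^ m`. This gives three possible weights, according to whether
`N(b)` is `1`, one of `g, g ^ 2, g ^ 4`, or one of `g ^ 3, g ^ 5, g ^ 6`; each fibre of `N` over
`Lˣ` has `(|K| - 1) / 7` elements.
The weights are positive because `|(1 + √-7) ^ m| ^ 2 = 8 ^ m = |K|`, so the map from
`b` to its codeword is injective.

The Davenport–Hasse relation is proved as by Weil. To a monic polynomial
`f = X ^ n - c₁ X ^ (n - 1) + ⋯ + (-1) ^ n cₙ` over a finite field attach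
`λ(f) = χ(cₙ) ψ(c₁)`, which is multiplicative. Unique factorization gives a Newton identity between
the sums of `λ` over all monic polynomials of a given degree, which vanish from degree two on, and
sums over powers of irreducible polynomials, which are the Gauss sums over the extension fields.
-/

noncomputable section

open Finset
open scoped Classical

/-! ### Newton's identity for a multiplicative weight on monic polynomials -/

namespace DavenportHasse

open Polynomial

variable {k R : Type*} [Field k] [Finite k] [CommRing R]

theorem finite_natDegree_le (n : ℕ) : {f : k[X] | f.natDegree ≤ n}.Finite := by
  refine Set.Finite.of_injOn (f := fun f (i : Fin (n + 1)) => f.coeff i) (t := Set.univ)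
    (fun _ _ => Set.mem_univ _) ?_ Set.finite_univ
  intro f hf g hg h
  ext i
  by_cases hi : i < n + 1
  · exact congrFun h ⟨i, hi⟩
  · simp only [Set.mem_ofPred_eq] at hf hg
    rw [coeff_eq_zero_of_natDegree_lt (by omega), coeff_eq_zero_of_natDegree_lt (by omega)]

/-- The monic polynomials of degree `n` over a finite field. -/
def monics (k : Type*) [Field k] [Finite k] (n : ℕ) : Finset k[X] :=
  {f ∈ (finite_natDegree_le n).toFinset | f.Monic ∧ f.natDegree = n}

/-- The monic irreducible polynomials whose degree divides `n`, where `n ≠ 0`. (For `n = 0` the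
bound `natDegree ≤ n`, which keeps the set finite, leaves none.) -/
def primesDvd (k : Type*) [Field k] [Finite k] (n : ℕ) : Finset k[X] :=
  {P ∈ (finite_natDegree_le n).toFinset | P.Monic ∧ Irreducible P ∧ P.natDegree ∣ n}

theorem mem_monics {n : ℕ} {f : k[X]} : f ∈ monics k n ↔ f.Monic ∧ f.natDegree = n := by
  simp only [monics, mem_filter, Set.Finite.mem_toFinset, Set.mem_ofPred_eq]
  exact ⟨fun h => h.2, fun h => ⟨h.2.le, h⟩⟩

theorem mem_primesDvd {n : ℕ} (hn : n ≠ 0) {P : k[X]} :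
    P ∈ primesDvd k n ↔ P.Monic ∧ Irreducible P ∧ P.natDegree ∣ n := by
  simp only [primesDvd, mem_filter, Set.Finite.mem_toFinset, Set.mem_ofPred_eq]
  exact ⟨fun h => h.2, fun h => ⟨Nat.le_of_dvd (Nat.pos_of_ne_zero hn) h.2.2, h⟩⟩

omit [Finite k] in
/-- The multiplicity of `P` in `f`, counted by the degrees `j = i * deg P` of the powers `P ^ i`,
`i ≥ 1`, which divide `f`. -/
theorem card_pow_dvd {f P : k[X]} (hf : f.Monic) (hP : P.Monic) (hPi : Irreducible P) :
    #{j ∈ Icc 1 f.natDegree | P.natDegree ∣ j ∧ P ^ (j / P.natDegree) ∣ f} =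
      (UniqueFactorizationMonoid.normalizedFactors f).count P := by
  have hd : 0 < P.natDegree := hPi.natDegree_pos
  have key : ∀ i : ℕ,
      P ^ i ∣ f ↔ i ≤ (UniqueFactorizationMonoid.normalizedFactors f).count P := by
    intro i
    rw [pow_dvd_iff_le_emultiplicity,
      UniqueFactorizationMonoid.emultiplicity_eq_count_normalizedFactors hPi hf.ne_zero,
      hP.normalize_eq_self]
    exact Nat.cast_le
  rw [← Nat.card_Icc 1 ((UniqueFactorizationMonoid.normalizedFactors f).count P) |>.trans
    (Nat.add_sub_cancel _ _)]
  symm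
  refine card_bij (fun i _ => i * P.natDegree) ?_ ?_ ?_
  · intro i hi
    rw [mem_Icc] at hi
    simp only [mem_filter, mem_Icc, dvd_mul_left, true_and, Nat.mul_div_cancel i hd]
    have h2 := (key i).2 hi.2
    refine ⟨⟨Nat.mul_pos hi.1 hd, ?_⟩, h2⟩
    rw [← natDegree_pow]
    exact natDegree_le_of_dvd h2 hf.ne_zero
  · intro i _ j _ h
    exact Nat.eq_of_mul_eq_mul_right hd h
  · intro j hj
    simp only [mem_filter, mem_Icc] at hj
    obtain ⟨⟨h1, -⟩, h3, h4⟩ := hj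
    refine ⟨j / P.natDegree, ?_, Nat.div_mul_cancel h3⟩
    rw [mem_Icc]
    exact ⟨Nat.div_pos (Nat.le_of_dvd h1 h3) hd, (key _).1 h4⟩

/-- The degree of `f` as a sum of `deg P` over all powers `P ^ i` with `i ≥ 1` dividing `f`, sorted
by the degree `j` of the power. This is the polynomial analogue of `∑_{d ∣ n} Λ(d) = log n`. -/
theorem natDegree_eq_sum_primes {f : k[X]} (hf : f.Monic) :
    f.natDegree = ∑ j ∈ Icc 1 f.natDegree, ∑ P ∈ primesDvd k j,
      if P ^ (j / P.natDegree) ∣ f then P.natDegree else 0 := by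
  set S := UniqueFactorizationMonoid.normalizedFactors f with hS
  have hmem : ∀ P ∈ S, P.Monic ∧ Irreducible P := by
    intro P hP
    have hi := UniqueFactorizationMonoid.irreducible_of_normalized_factor P hP
    refine ⟨?_, hi⟩
    rw [← UniqueFactorizationMonoid.normalize_normalized_factor P hP]
    exact monic_normalize hi.ne_zero
  have hprod : S.prod = f := by
    rw [hS, UniqueFactorizationMonoid.prod_normalizedFactors_eq hf.ne_zero,
      hf.normalize_eq_self]
  have hdeg : f.natDegree = ∑ P ∈ S.toFinset, S.count P * P.natDegree := by
    conv_lhs => rw [← hprod]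
    rw [natDegree_multiset_prod_of_monic S fun P hP => (hmem P hP).1,
      Finset.sum_multiset_map_count]
    simp
  conv_lhs => rw [hdeg]
  simp_rw [← sum_filter]
  rw [sum_comm' (t' := S.toFinset)
    (s' := fun P => {j ∈ Icc 1 f.natDegree | P.natDegree ∣ j ∧ P ^ (j / P.natDegree) ∣ f})]
  · refine sum_congr rfl fun P hP => ?_
    have := hmem P (Multiset.mem_toFinset.1 hP)
    rw [sum_const, card_pow_dvd hf this.1 this.2, smul_eq_mul]
  · intro j P
    simp only [mem_filter, Multiset.mem_toFinset]
    constructor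
    · rintro ⟨hj, hP, hd⟩
      have hj' := mem_Icc.1 hj
      rw [mem_primesDvd (by omega)] at hP
      refine ⟨⟨hj, hP.2.2, hd⟩, ?_⟩
      have hne : j / P.natDegree ≠ 0 :=
        (Nat.div_pos (Nat.le_of_dvd (by omega) hP.2.2) hP.2.1.natDegree_pos).ne'
      rw [hS, UniqueFactorizationMonoid.mem_normalizedFactors_iff' hf.ne_zero]
      exact ⟨hP.2.1, hP.1.normalize_eq_self, (dvd_pow_self P hne).trans hd⟩
    · rintro ⟨⟨hj, h1, h2⟩, hP⟩
      have hj' := mem_Icc.1 hj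
      exact ⟨hj, (mem_primesDvd (by omega)).2 ⟨(hmem P hP).1, (hmem P hP).2, h1⟩, h2⟩

/-- The weight `λ(f) = χ(cₙ) ψ(c₁)` of a monic `f = X ^ n - c₁ X ^ (n - 1) + ⋯ + (-1) ^ n cₙ`.
If `f` is the characteristic polynomial of `x`, then `cₙ` is the norm and `c₁` the trace of `x`. -/
def weight (χ : MulChar k R) (ψ : AddChar k R) (f : k[X]) : R :=
  χ ((-1) ^ f.natDegree * f.coeff 0) * ψ (-f.nextCoeff)

variable (χ : MulChar k R) (ψ : AddChar k R)

omit [Finite k] in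
theorem weight_mul {f g : k[X]} (hf : f.Monic) (hg : g.Monic) :
    weight χ ψ (f * g) = weight χ ψ f * weight χ ψ g := by
  simp only [weight, hf.natDegree_mul hg, hf.nextCoeff_mul hg, mul_coeff_zero, neg_add,
    AddChar.map_add_eq_mul, pow_add, map_mul]
  ring

omit [Finite k] in
theorem weight_one : weight χ ψ 1 = 1 := by
  simp [weight, nextCoeff]

omit [Finite k] in
theorem weight_pow {f : k[X]} (hf : f.Monic) (i : ℕ) :
    weight χ ψ (f ^ i) = weight χ ψ f ^ i := by
  induction i with
  | zero => simp [weight_one]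
  | succ i ih => rw [pow_succ, weight_mul χ ψ (hf.pow i) hf, ih, pow_succ]

/-- The sum of `weight` over the monic polynomials of degree `n`. -/
def monicSum (n : ℕ) : R := ∑ f ∈ monics k n, weight χ ψ f

/-- The sum of `deg P * weight (P ^ i)` over the prime powers `P ^ i` of degree `n`. -/
def primeSum (n : ℕ) : R :=
  ∑ P ∈ primesDvd k n, (P.natDegree : R) * weight χ ψ P ^ (n / P.natDegree)

theorem sum_monics_dvd {n : ℕ} {g : k[X]} (hg : g.Monic) (hn : g.natDegree ≤ n) :
    ∑ f ∈ monics k n with g ∣ f, weight χ ψ f =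
      weight χ ψ g * monicSum χ ψ (n - g.natDegree) := by
  rw [monicSum, mul_sum]
  symm
  refine sum_bij (fun f _ => g * f) ?_ ?_ ?_ ?_
  · intro f hf
    rw [mem_monics] at hf
    rw [mem_filter, mem_monics, hg.natDegree_mul hf.1]
    exact ⟨⟨hg.mul hf.1, by omega⟩, dvd_mul_right _ _⟩
  · intro f _ f' _ h
    exact mul_left_cancel₀ hg.ne_zero h
  · intro f hf
    rw [mem_filter, mem_monics] at hf
    obtain ⟨⟨h1, h2⟩, e, rfl⟩ := hf
    have he := hg.of_mul_monic_left h1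
    refine ⟨e, ?_, rfl⟩
    rw [hg.natDegree_mul he] at h2
    exact mem_monics.2 ⟨he, by omega⟩
  · intro f hf
    exact (weight_mul χ ψ hg (mem_monics.1 hf).1).symm

/-- Newton's identity: weighting each monic `f` by its degree and expanding the degree by
`natDegree_eq_sum_primes`. -/
theorem natCast_mul_monicSum (n : ℕ) :
    (n : R) * monicSum χ ψ n =
      ∑ j ∈ Icc 1 n, primeSum χ ψ j * monicSum χ ψ (n - j) := by
  have h1 : (n : R) * monicSum χ ψ n = ∑ f ∈ monics k n, ∑ j ∈ Icc 1 n, ∑ P ∈ primesDvd k j,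
      if P ^ (j / P.natDegree) ∣ f then (P.natDegree : R) * weight χ ψ f else 0 := by
    rw [monicSum, mul_sum]
    refine sum_congr rfl fun f hf => ?_
    obtain ⟨hm, hd⟩ := mem_monics.1 hf
    have := congrArg (fun m : ℕ => (m : R) * weight χ ψ f) (natDegree_eq_sum_primes hm)
    simp only [hd, Nat.cast_sum, sum_mul, Nat.cast_ite, ite_mul, Nat.cast_zero, zero_mul] at this
    exact this
  rw [h1, sum_comm]
  refine sum_congr rfl fun j hj => ?_
  rw [sum_comm, primeSum, sum_mul]
  refine sum_congr rfl fun P hP => ?_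
  rw [mem_Icc] at hj
  obtain ⟨hPm, hPi, hPd⟩ := (mem_primesDvd (by omega)).1 hP
  have hdeg : (P ^ (j / P.natDegree)).natDegree = j := by
    rw [natDegree_pow, Nat.div_mul_cancel hPd]
  rw [← sum_filter, ← mul_sum, sum_monics_dvd χ ψ (hPm.pow _) (by omega), hdeg,
    weight_pow χ ψ hPm, mul_assoc]

theorem monicSum_zero : monicSum χ ψ 0 = 1 := by
  have : monics k 0 = {1} := by
    ext f
    rw [mem_monics, mem_singleton]
    exact ⟨fun h => (h.1.natDegree_eq_zero).1 h.2, by rintro rfl; simp⟩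
  rw [monicSum, this, sum_singleton, weight_one]

theorem monicSum_one [Fintype k] : monicSum χ ψ 1 = gaussSum χ ψ := by
  rw [monicSum, gaussSum]
  symm
  refine sum_bij (fun a _ => X - C a) ?_ ?_ ?_ ?_
  · intro a _
    exact mem_monics.2 ⟨monic_X_sub_C a, natDegree_X_sub_C a⟩
  · intro a _ b _ h
    simpa using h
  · intro f hf
    obtain ⟨h1, h2⟩ := mem_monics.1 hf
    refine ⟨-f.coeff 0, mem_univ _, ?_⟩
    rw [h1.eq_X_add_C h2]
    simp
  · intro a _
    simp [weight, nextCoeff_X_sub_C]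

/-- For `n ≥ 2` the map `f ↦ f + c X ^ (n - 1)` keeps the constant coefficient of a monic `f` of
degree `n`, so it multiplies the weight by `ψ (-c)`; as it permutes the monic polynomials of degree
`n`, the sum is invariant under multiplication by `ψ c`. The regularity of `1 - ψ c`
replaces the usual assumptions that `R` is a domain and `ψ ≠ 1`. -/
theorem monicSum_eq_zero {n : ℕ} (hn : 2 ≤ n) {c : k} (hc : IsLeftRegular (1 - ψ c)) :
    monicSum χ ψ n = 0 := by
  apply hc
  simp only
  rw [mul_zero, sub_mul, one_mul, sub_eq_zero, monicSum, mul_sum]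
  have aux : ∀ (b : k), ∀ f ∈ monics k n, f + C b * X ^ (n - 1) ∈ monics k n := by
    intro b f hf
    obtain ⟨h1, h2⟩ := mem_monics.1 hf
    have hlt : (C b * X ^ (n - 1)).degree < f.degree := by
      refine (degree_C_mul_X_pow_le _ _).trans_lt ?_
      rw [degree_eq_natDegree h1.ne_zero, h2]
      exact_mod_cast (by omega : n - 1 < n)
    exact mem_monics.2 ⟨h1.add_of_left hlt, by rw [natDegree_add_eq_left_of_degree_lt hlt, h2]⟩
  refine sum_bij' (fun f _ => f + C c * X ^ (n - 1)) (fun f _ => f + C (-c) * X ^ (n - 1))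
    (aux c) (aux (-c)) (by intros; simp) (by intros; simp) ?_
  intro f hf
  have h2 := (mem_monics.1 hf).2
  have h3 := (mem_monics.1 (aux c f hf)).2
  have h4 : (f + C c * X ^ (n - 1)).coeff 0 = f.coeff 0 := by
    simp [show ¬ (0 = n - 1) by omega, coeff_X_pow]
  rw [weight, weight, h2, h3, nextCoeff_of_natDegree_pos (by omega),
    nextCoeff_of_natDegree_pos (by omega), h2, h3, h4, coeff_add, coeff_C_mul_X_pow, if_pos rfl,
    neg_add, AddChar.map_add_eq_mul]
  have h5 : ψ c * ψ (-c) = 1 := by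
    rw [← AddChar.map_add_eq_mul, add_neg_cancel, AddChar.map_zero_eq_one]
  linear_combination (-χ ((-1) ^ n * f.coeff 0) * ψ (-f.coeff (n - 1))) * h5

/-! ### The Davenport–Hasse relation -/

variable {K : Type*} [Field K] [Algebra k K]

omit [Finite k] in
/-- The characteristic polynomial of `x` is a power of its minimal polynomial. -/
theorem norm_trace_eq_weight [Finite K] (x : K) :
    χ (Algebra.norm k x) * ψ (Algebra.trace k K x) =
      weight χ ψ (minpoly k x) ^ (Module.finrank k K / (minpoly k x).natDegree) := by
  have hx : IsIntegral k x := Algebra.IsIntegral.isIntegral x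
  have hd : Module.finrank k K / (minpoly k x).natDegree =
      Module.finrank (IntermediateField.adjoin k {x}) K := by
    rw [← Module.finrank_mul_finrank k (IntermediateField.adjoin k {x}) K,
      IntermediateField.adjoin.finrank hx]
    exact Nat.mul_div_cancel_left _ (minpoly.natDegree_pos hx)
  have hN : Algebra.norm k (IntermediateField.AdjoinSimple.gen k x) =
      (-1) ^ (minpoly k x).natDegree * (minpoly k x).coeff 0 := by
    have := Algebra.PowerBasis.norm_gen_eq_coeff_zero_minpoly
      (IntermediateField.adjoin.powerBasis hx)
    rwa [IntermediateField.adjoin.powerBasis_gen, IntermediateField.minpoly_gen,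
      IntermediateField.adjoin.powerBasis_dim] at this
  rw [Algebra.norm_eq_norm_adjoin, trace_eq_finrank_mul_minpoly_nextCoeff, hN, hd, map_pow,
    ← nsmul_eq_mul, AddChar.map_nsmul_eq_pow, ← mul_pow, weight]

/-- An irreducible polynomial whose degree divides `[K : k]` splits in `K` into distinct factors. -/
theorem card_minpoly_fiber [Fintype K] {P : k[X]}
    (hP : P ∈ primesDvd k (Module.finrank k K)) :
    #{x : K | minpoly k x = P} = P.natDegree := by
  obtain ⟨hm, hi, hd⟩ := (mem_primesDvd Module.finrank_pos.ne').1 hP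
  have hdvd := hi.natDegree_dvd_iff_dvd_X_pow_card_pow_sub_X.1 hd
  rw [← Module.natCard_eq_pow_finrank] at hdvd
  have hsplit : (P.map (algebraMap k K)).Splits := by
    have h1 := (FiniteField.isSplittingField_sub K k).splits
    rw [Fintype.card_eq_nat_card] at h1
    refine h1.of_dvd (map_ne_zero ?_) (Polynomial.map_dvd _ hdvd)
    exact FiniteField.X_pow_card_sub_X_ne_zero _ Finite.one_lt_card
  have hsep : P.Separable := PerfectField.separable_of_irreducible hi
  rw [← card_rootSet_eq_natDegree hsep hsplit, ← Set.toFinset_card]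
  congr 1
  ext x
  simp only [mem_filter, mem_univ, true_and, Set.mem_toFinset, mem_rootSet, hm.ne_zero, ne_eq,
    not_false_eq_true]
  exact ⟨by rintro rfl; exact minpoly.aeval _ _, fun h =>
    (minpoly.eq_of_irreducible_of_monic hi h hm).symm⟩

/-- The lifted Gauss sum is the prime power sum: group the `x : K` by minimal polynomial. -/
theorem sum_norm_trace [Fintype K] :
    ∑ x : K, χ (Algebra.norm k x) * ψ (Algebra.trace k K x) =
      primeSum χ ψ (Module.finrank k K) := by
  rw [← sum_fiberwise_of_maps_to (s := univ) (t := primesDvd k (Module.finrank k K))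
    (g := fun x : K => minpoly k x), primeSum]
  · refine sum_congr rfl fun P hP => ?_
    rw [← card_minpoly_fiber hP, ← nsmul_eq_mul, ← sum_const]
    refine sum_congr rfl fun x hx => ?_
    rw [card_minpoly_fiber hP, norm_trace_eq_weight, (mem_filter.1 hx).2]
  · intro x _
    have hx : IsIntegral k x := Algebra.IsIntegral.isIntegral x
    exact (mem_primesDvd Module.finrank_pos.ne').2
      ⟨minpoly.monic hx, minpoly.irreducible hx, minpoly.degree_dvd hx⟩

theorem primeSum_eq [Fintype k] {c : k} (hc : IsLeftRegular (1 - ψ c)) (n : ℕ) :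
    primeSum χ ψ (n + 1) = (-1) ^ n * gaussSum χ ψ ^ (n + 1) := by
  induction n with
  | zero =>
    have := natCast_mul_monicSum χ ψ 1
    simpa [monicSum_zero, monicSum_one] using this.symm
  | succ n ih =>
    have := natCast_mul_monicSum χ ψ (n + 2)
    rw [monicSum_eq_zero χ ψ (by omega) hc, mul_zero, sum_Icc_succ_top (by omega),
      sum_Icc_succ_top (by omega), sum_eq_zero, Nat.sub_self, monicSum_zero,
      show n + 2 - (n + 1) = 1 by omega, monicSum_one, ih] at this
    · linear_combination -this
    · intro j hj
      rw [mem_Icc] at hj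
      rw [monicSum_eq_zero χ ψ (by omega) hc, mul_zero]

/-- The **Davenport–Hasse relation** for Gauss sums of characters lifted from `k` to a finite
extension `K` by the norm and the trace, with values in a commutative ring. -/
theorem davenport_hasse [Fintype k] [Fintype K] {c : k} (hc : IsLeftRegular (1 - ψ c)) :
    ∑ x : K, χ (Algebra.norm k x) * ψ (Algebra.trace k K x) =
      -(-gaussSum χ ψ) ^ Module.finrank k K := by
  obtain ⟨n, hn⟩ : ∃ n, Module.finrank k K = n + 1 :=
    Nat.exists_eq_succ_of_ne_zero Module.finrank_pos.ne'
  rw [sum_norm_trace, hn, primeSum_eq χ ψ hc, neg_pow (gaussSum χ ψ)]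
  ring

end DavenportHasse

namespace TraceCode

/-! ### The sign character of the field of order two -/

section Sign

variable {F : Type*} [Field F]

theorem eq_zero_or_one_of_card (hq : Nat.card F = 2) (x : F) : x = 0 ∨ x = 1 := by
  have : Finite F := Nat.finite_of_card_ne_zero (by omega)
  have := Fintype.ofFinite F
  by_contra! h
  have h3 := Finset.card_le_univ ({0, 1, x} : Finset F)
  rw [← Nat.card_eq_fintype_card, hq, Finset.card_eq_three.2
    ⟨0, 1, x, zero_ne_one, h.1.symm, h.2.symm, rfl⟩] at h3
  omega

theorem two_eq_zero_of_card (hq : Nat.card F = 2) : (2 : F) = 0 := by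
  rcases eq_zero_or_one_of_card hq (2 : F) with h | h
  · exact h
  · exact absurd (by linear_combination h : (1 : F) = 0) one_ne_zero

/-- The additive character `x ↦ (-1) ^ x` of the field with two elements. -/
def signChar (hq : Nat.card F = 2) : AddChar F ℝ where
  toFun x := if x = 0 then 1 else -1
  map_zero_eq_one' := if_pos rfl
  map_add_eq_mul' x y := by
    have h2 : (1 : F) + 1 = 0 := by rw [one_add_one_eq_two, two_eq_zero_of_card hq]
    rcases eq_zero_or_one_of_card hq x with rfl | rfl <;>
      rcases eq_zero_or_one_of_card hq y with rfl | rfl <;> simp [h2]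

theorem signChar_apply (hq : Nat.card F = 2) (x : F) :
    signChar hq x = if x = 0 then 1 else -1 := rfl

end Sign

/-! ### The field of order eight -/

section FieldOfOrderEight

variable {F L : Type*} [Field F] [Field L] [Algebra F L]

theorem card_eq_eight (hq : Nat.card F = 2) (hf : Module.finrank F L = 3) : Nat.card L = 8 := by
  have : Finite F := Nat.finite_of_card_ne_zero (by omega)
  have : Module.Finite F L := Module.finite_of_finrank_pos (by omega)
  rw [Module.natCard_eq_pow_finrank (K := F), hq, hf]
  norm_num

theorem two_eq_zero_of_algebra (hq : Nat.card F = 2) : (2 : L) = 0 := by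
  rw [← map_ofNat (algebraMap F L) 2, two_eq_zero_of_card hq, map_zero]

/-- Over `𝔽₂`, `x ^ 7 - 1 = (x - 1)(x ^ 3 + x + 1)(x ^ 3 + x ^ 2 + 1)`, and inversion exchanges the
roots of the two cubics. Any root `g` of the first cubic generates `Lˣ`. -/
theorem exists_root_cubic (h8 : Nat.card L = 8) (h2 : (2 : L) = 0) :
    ∃ g : Lˣ, (g : L) ^ 3 + g + 1 = 0 := by
  have : Finite L := Nat.finite_of_card_ne_zero (by omega)
  have := Fintype.ofFinite L
  rw [Nat.card_eq_fintype_card] at h8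
  obtain ⟨x, hx⟩ : ∃ x : L, x ∉ ({0, 1} : Finset L) := by
    by_contra! h
    have := Finset.card_le_card (fun x _ => h x : (univ : Finset L) ⊆ {0, 1})
    rw [card_univ, h8] at this
    exact absurd (this.trans card_le_two) (by norm_num)
  simp only [mem_insert, mem_singleton, not_or] at hx
  have h7 : x ^ 7 = 1 := by
    have := FiniteField.pow_card_sub_one_eq_one x hx.1
    rwa [h8] at this
  have hprod : (x - 1) * ((x ^ 3 + x + 1) * (x ^ 3 + x ^ 2 + 1)) = 0 := by
    linear_combination h7 + (x - 1) * x ^ 3 * h2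
  have hne : x - 1 ≠ 0 := sub_ne_zero.2 hx.2
  rcases mul_eq_zero.1 ((mul_eq_zero.1 hprod).resolve_left hne) with h | h
  · exact ⟨Units.mk0 x hx.1, h⟩
  · refine ⟨(Units.mk0 x hx.1)⁻¹, ?_⟩
    have h0 := hx.1
    simp only [Units.val_inv_eq_inv_val, Units.val_mk0]
    field_simp
    linear_combination h

variable {g : Lˣ} (hg : (g : L) ^ 3 + g + 1 = 0)
include hg

theorem geom_sum_eq_zero (h2 : (2 : L) = 0) :
    1 + (g : L) + g ^ 2 + g ^ 3 + g ^ 4 + g ^ 5 + g ^ 6 = 0 := by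
  linear_combination ((g : L) ^ 3 + g ^ 2 + 1) * hg - g ^ 3 * h2

theorem pow_seven_eq_one (h2 : (2 : L) = 0) : (g : L) ^ 7 = 1 := by
  linear_combination ((g : L) - 1) * geom_sum_eq_zero hg h2

theorem orderOf_eq_seven (h2 : (2 : L) = 0) : orderOf g = 7 := by
  have : Fact (Nat.Prime 7) := ⟨by norm_num⟩
  refine orderOf_eq_prime (Units.ext (by simpa using pow_seven_eq_one hg h2)) ?_
  rintro rfl
  refine one_ne_zero (α := L) ?_
  simp only [Units.val_one] at hg
  linear_combination hg - h2

theorem injOn_pow (h2 : (2 : L) = 0) : Set.InjOn (fun i : ℕ => g ^ i) (range 7 : Set ℕ) := by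
  have := pow_injOn_Iio_orderOf (x := g)
  rw [orderOf_eq_seven hg h2] at this
  intro i hi j hj h
  exact this (by simpa using hi) (by simpa using hj) h

theorem image_pow_eq_univ [Fintype Lˣ] (h8 : Nat.card L = 8) (h2 : (2 : L) = 0) :
    (range 7).image (fun i => g ^ i) = (univ : Finset Lˣ) := by
  refine eq_univ_of_card _ ?_
  rw [card_image_of_injOn (injOn_pow hg h2), card_range, ← Nat.card_eq_fintype_card,
    Nat.card_units, h8]

theorem sum_units_eq [Fintype Lˣ] {M : Type*} [AddCommMonoid M] (h8 : Nat.card L = 8)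
    (h2 : (2 : L) = 0) (f : Lˣ → M) : ∑ u, f u = ∑ i ∈ range 7, f (g ^ i) := by
  rw [← image_pow_eq_univ hg h8 h2, sum_image (injOn_pow hg h2)]

theorem exists_pow_eq (h8 : Nat.card L = 8) (h2 : (2 : L) = 0) (u : Lˣ) :
    ∃ i < 7, g ^ i = u := by
  have : Finite L := Nat.finite_of_card_ne_zero (by omega)
  have := Fintype.ofFinite Lˣ
  have := mem_univ u
  rw [← image_pow_eq_univ hg h8 h2] at this
  simpa using this

/-- The trace of `g ^ i` is `g ^ i + g ^ (2 i) + g ^ (4 i)`; it vanishes on the conjugates of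
`g` only, among the powers of `g`. -/
theorem signChar_trace_pow (hq : Nat.card F = 2) (hf : Module.finrank F L = 3) {i : ℕ}
    (hi : i < 7) : signChar hq (Algebra.trace F L (g ^ i)) =
      if i ∈ ({1, 2, 4} : Finset ℕ) then 1 else -1 := by
  have h8 := card_eq_eight (L := L) hq hf
  have : Finite L := Nat.finite_of_card_ne_zero (by omega)
  have h2 := two_eq_zero_of_algebra (L := L) hq
  have h7 := pow_seven_eq_one hg h2
  have hs := geom_sum_eq_zero hg h2
  have ht : (g : L) + g ^ 2 + g ^ 4 = 0 := by linear_combination (g : L) * hg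
  have htr := FiniteField.algebraMap_trace_eq_sum_pow F L ((g : L) ^ i)
  simp only [hf, hq, sum_range_succ, sum_range_zero] at htr
  have hzero : i ∈ ({1, 2, 4} : Finset ℕ) → algebraMap F L (Algebra.trace F L (g ^ i)) = 0 := by
    intro h
    rw [htr]
    simp only [mem_insert, mem_singleton] at h
    rcases h with rfl | rfl | rfl
    · linear_combination ht
    · linear_combination ht + (g : L) * h7
    · linear_combination ht + ((g : L) + (g ^ 9 + g ^ 2)) * h7
  have hone : i ∉ ({1, 2, 4} : Finset ℕ) → algebraMap F L (Algebra.trace F L (g ^ i)) = 1 := by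
    intro h
    rw [htr]
    simp only [mem_insert, mem_singleton, not_or] at h
    obtain rfl | rfl | rfl | rfl : i = 0 ∨ i = 3 ∨ i = 5 ∨ i = 6 := by omega
    · linear_combination h2
    · linear_combination hs - ht + (g : L) ^ 5 * h7 - h2
    · linear_combination hs - ht + ((g : L) ^ 3 + (g ^ 13 + g ^ 6)) * h7 - h2
    · linear_combination hs - ht + ((g : L) ^ 5 + (g ^ 17 + g ^ 10 + g ^ 3)) * h7 - h2
  rw [signChar_apply]
  by_cases h : i ∈ ({1, 2, 4} : Finset ℕ)
  · rw [if_pos h, if_pos]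
    exact (algebraMap F L).injective (by rw [hzero h, map_zero])
  · rw [if_neg h, if_neg]
    intro h0
    have := hone h
    rw [h0, map_zero] at this
    exact zero_ne_one this

end FieldOfOrderEight

/-! ### The Gauss sum with values in the group ring -/

section GroupRing

/-- The universal multiplicative character of `L`, which sends a unit to itself in the group ring
of `Lˣ`. A sum of its values records all fibre sums at once, as coefficients. -/
def groupRingChar (L : Type*) [Field L] : MulChar L (MonoidAlgebra ℝ Lˣ) :=
  MulChar.ofUnitHom (MonoidAlgebra.of ℝ Lˣ).toHomUnits

theorem groupRingChar_coe {L : Type*} [Field L] (u : Lˣ) :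
    groupRingChar L u = MonoidAlgebra.of ℝ Lˣ u := by
  rw [groupRingChar, MulChar.ofUnitHom_coe]
  rfl

/-- The additive character `y ↦ (-1) ^ Tr(y)` of `L`, as a map to scalars of the group ring. -/
def traceSignChar (F L : Type*) [Field F] [Field L] [Algebra F L] (hq : Nat.card F = 2) :
    AddChar L (MonoidAlgebra ℝ Lˣ) :=
  ((algebraMap ℝ (MonoidAlgebra ℝ Lˣ)).toMonoidHom.compAddChar (signChar hq)).compAddMonoidHom
    (Algebra.trace F L).toAddMonoidHom

theorem traceSignChar_apply {F L : Type*} [Field F] [Field L] [Algebra F L]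
    (hq : Nat.card F = 2) (y : L) :
    traceSignChar F L hq y =
      algebraMap ℝ (MonoidAlgebra ℝ Lˣ) (signChar hq (Algebra.trace F L y)) := rfl

/-- The closed form of the period sum over the elements of norm `g ^ i`, `i < 7`, in an extension of
degree `m` of the field of order eight. It is a combination of the real and imaginary parts of
`(1 + √-7) ^ m`, and `{1, 2, 4}` are the exponents `i` with `Tr(g ^ i) = 0`. -/
def period (m i : ℕ) : ℝ :=
  let z : ℂ := (1 + (√7 : ℂ) * Complex.I) ^ m
  if i = 0 then -(6 * ((z.re - 1) / 7) + 1)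
  else if i ∈ ({1, 2, 4} : Finset ℕ) then (z.re - 1) / 7 + z.im / √7
  else (z.re - 1) / 7 - z.im / √7

/-- Together with `im_pow_succ_div`: the recursion `(X, Y) ↦ (X - 7 Y, X + Y)` for
`X + Y √-7 = (1 + √-7) ^ m`. -/
theorem re_pow_succ (m : ℕ) : ((1 + (√7 : ℂ) * Complex.I) ^ (m + 1)).re =
    ((1 + (√7 : ℂ) * Complex.I) ^ m).re - 7 * (((1 + (√7 : ℂ) * Complex.I) ^ m).im / √7) := by
  have h7 : √7 * √7 = 7 := Real.mul_self_sqrt (by norm_num)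
  rw [pow_succ]
  simp
  field_simp
  linear_combination ((1 + (√7 : ℂ) * Complex.I) ^ m).im * h7

theorem im_pow_succ_div (m : ℕ) : ((1 + (√7 : ℂ) * Complex.I) ^ (m + 1)).im / √7 =
    ((1 + (√7 : ℂ) * Complex.I) ^ m).re + ((1 + (√7 : ℂ) * Complex.I) ^ m).im / √7 := by
  rw [pow_succ]
  simp
  field_simp

/-- The powers of `1 - A + B`, where `A = α + α ^ 2 + α ^ 4` and `B = α ^ 3 + α ^ 5 + α ^ 6`. They
lie in the span of `1, A, B`, as `A ^ 2 = A + 2 B`, `A B = 3 + A + B` and `B ^ 2 = B + 2 A`. -/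
theorem neg_neg_pow_eq_sum_period {A : Type*} [CommRing A] [Algebra ℝ A] {α : A} (h7 : α ^ 7 = 1)
    (m : ℕ) :
    -(-∑ i ∈ range 7, (if i ∈ ({1, 2, 4} : Finset ℕ) then (1 : ℝ) else -1) • α ^ i) ^ m =
      ∑ i ∈ range 7, period m i • α ^ i := by
  rw [neg_eq_iff_eq_neg]
  induction m with
  | zero => simp [sum_range_succ, period]
  | succ m ih =>
    rw [pow_succ, ih]
    simp only [sum_range_succ, sum_range_zero, period, re_pow_succ, im_pow_succ_div]
    -- rewrite the recursion in `x = (X - 1) / 7` and `y = Y`, to which `period` refers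
    rw [show (((1 + (√7 : ℂ) * Complex.I) ^ m).re -
        7 * (((1 + (√7 : ℂ) * Complex.I) ^ m).im / √7) - 1) / 7 =
        (((1 + (√7 : ℂ) * Complex.I) ^ m).re - 1) / 7 -
          ((1 + (√7 : ℂ) * Complex.I) ^ m).im / √7 by ring,
      show ((1 + (√7 : ℂ) * Complex.I) ^ m).re =
        7 * ((((1 + (√7 : ℂ) * Complex.I) ^ m).re - 1) / 7) + 1 by ring]
    simp only [add_sub_cancel_right, mul_div_cancel_left₀ _ (by norm_num : (7 : ℝ) ≠ 0)]
    generalize (((1 + (√7 : ℂ) * Complex.I) ^ m).re - 1) / 7 = x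
    generalize ((1 + (√7 : ℂ) * Complex.I) ^ m).im / √7 = y
    simp only [Algebra.smul_def, mem_insert, mem_singleton]
    norm_num [map_ofNat (algebraMap ℝ A)]
    generalize algebraMap ℝ A x = x
    generalize algebraMap ℝ A y = y
    -- the cofactor is the quotient of the difference of the two sides by `α ^ 7 - 1`
    linear_combination (-6 * y + (y - x) * α - 2 * x * α ^ 2 - (x + y) * α ^ 3 +
      2 * (y - x) * α ^ 4 + (y - x) * α ^ 5) * h7

variable {F L : Type*} [Field F] [Field L] [Algebra F L]
  {g : Lˣ} (hg : (g : L) ^ 3 + g + 1 = 0)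
include hg

/-- The Gauss sum over `L` is `-1 + A - B` in the group ring. -/
theorem gaussSum_eq [Fintype L] (hq : Nat.card F = 2) (hf : Module.finrank F L = 3) :
    gaussSum (groupRingChar L) (traceSignChar F L hq) =
      ∑ i ∈ range 7, (if i ∈ ({1, 2, 4} : Finset ℕ) then (1 : ℝ) else -1) •
        MonoidAlgebra.of ℝ Lˣ (g ^ i) := by
  have := Fintype.ofFinite Lˣ
  rw [gaussSum, ← Fintype.sum_subtype_add_sum_subtype (fun y : L => y ≠ 0)]
  rw [add_eq_left.2 (Finset.sum_eq_zero fun y _ => ?_)]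
  · rw [← Equiv.sum_comp (unitsEquivNeZero (G₀ := L)), sum_units_eq hg (card_eq_eight hq hf)
      (two_eq_zero_of_algebra hq)]
    refine sum_congr rfl fun i hi => ?_
    rw [unitsEquivNeZero_apply_coe, groupRingChar_coe, traceSignChar_apply,
      Units.val_pow_eq_pow_val, signChar_trace_pow hg hq hf (mem_range.1 hi), mul_comm,
      Algebra.smul_def]
  · rw [not_not.1 y.2, MulChar.map_zero, zero_mul]

theorem neg_neg_gaussSum_pow [Fintype L] (hq : Nat.card F = 2) (hf : Module.finrank F L = 3)
    (m : ℕ) :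
    -(-gaussSum (groupRingChar L) (traceSignChar F L hq)) ^ m =
      ∑ i ∈ range 7, period m i • MonoidAlgebra.of ℝ Lˣ (g ^ i) := by
  rw [gaussSum_eq hg hq hf]
  have h7 : MonoidAlgebra.of ℝ Lˣ g ^ 7 = 1 := by
    rw [← map_pow, ← map_one (MonoidAlgebra.of ℝ Lˣ)]
    exact congrArg _ (Units.ext (by simpa using pow_seven_eq_one hg (two_eq_zero_of_algebra hq)))
  simpa only [map_pow] using neg_neg_pow_eq_sum_period h7 m

end GroupRing

/-! ### Period sums and fibres of the norm -/

section Periods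

variable {F L K : Type*} [Field F] [Field L] [Field K] [Fintype K]
  [Algebra F L] [Algebra L K] [Algebra F K] [IsScalarTower F L K]
  {g : Lˣ} (hg : (g : L) ^ 3 + g + 1 = 0)

include hg in
/-- The period sums in closed form: compare the coefficients of `g ^ i` in the Davenport–Hasse
relation in the group ring of `Lˣ`. -/
theorem sum_norm_eq_pow (hq : Nat.card F = 2) (hf : Module.finrank F L = 3) {i : ℕ} (hi : i < 7) :
    ∑ x : K with Algebra.norm L x = g ^ i, signChar hq (Algebra.trace F K x) =
      period (Module.finrank L K) i := by
  have h8 := card_eq_eight (L := L) hq hf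
  have h2 := two_eq_zero_of_algebra (L := L) hq
  have : Finite L := Nat.finite_of_card_ne_zero (by omega)
  have := Fintype.ofFinite L
  have : Finite F := Nat.finite_of_card_ne_zero (by omega)
  have : Module.Finite F L := Module.finite_of_finrank_pos (by omega)
  have hψ : traceSignChar F L hq 1 = -1 := by
    have := signChar_trace_pow hg hq hf (i := 0) (by norm_num)
    rw [traceSignChar_apply, ← pow_zero (g : L), this]
    simp [← MonoidAlgebra.one_def]
  -- `ψ 1 = -1` because the degree of `L` over `F` is odd, and `1 - ψ 1 = 2` is a unit
  have hreg : IsLeftRegular (1 - traceSignChar F L hq 1) := by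
    have : IsUnit (algebraMap ℝ (MonoidAlgebra ℝ Lˣ) 2) :=
      (IsUnit.mk0 (2 : ℝ) two_ne_zero).map _
    rw [hψ, sub_neg_eq_add, one_add_one_eq_two, ← map_ofNat (algebraMap ℝ (MonoidAlgebra ℝ Lˣ)) 2]
    exact this.isRegular.left
  have hDH := DavenportHasse.davenport_hasse (K := K) (groupRingChar L) (traceSignChar F L hq) hreg
  rw [neg_neg_gaussSum_pow hg hq hf] at hDH
  have hcoeff := congrArg (fun a => a.coeff (g ^ i)) hDH
  simp only [MonoidAlgebra.coeff_sum, Finsupp.finsetSum_apply] at hcoeff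
  rw [sum_eq_single_of_mem i (mem_range.2 hi)] at hcoeff
  · have hR : (period (Module.finrank L K) i • MonoidAlgebra.of ℝ Lˣ (g ^ i)).coeff (g ^ i) =
        period (Module.finrank L K) i := by simp
    rw [hR] at hcoeff
    rw [← hcoeff, sum_filter]
    refine sum_congr rfl fun x _ => ?_
    rw [traceSignChar_apply, Algebra.trace_trace, mul_comm, ← Algebra.smul_def,
      MonoidAlgebra.coeff_smul, Finsupp.smul_apply]
    by_cases hx : Algebra.norm L x = 0
    · rw [hx, MulChar.map_zero, if_neg (pow_ne_zero _ g.ne_zero).symm]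
      simp
    · obtain ⟨u, hu⟩ := (isUnit_iff_ne_zero.2 hx)
      rw [← hu, groupRingChar_coe, ← Units.val_pow_eq_pow_val, Units.val_inj]
      simp [Finsupp.single_apply]
  · intro j hj hne
    have : g ^ j ≠ g ^ i := fun h =>
      hne (injOn_pow hg h2 hj (mem_coe.2 (mem_range.2 hi)) h)
    simp [this]

theorem sum_eq_sum_norm_fibers [Fintype Lˣ] {M : Type*} [AddCommMonoid M] (f : K → M) :
    ∑ x, f x = f 0 + ∑ u : Lˣ, ∑ x : K with Algebra.norm L x = u, f x := by
  rw [← sum_biUnion, ← add_sum_erase _ _ (mem_univ (0 : K))]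
  · congr 2
    ext x
    simp only [mem_erase, mem_univ, and_true, mem_biUnion, mem_filter, true_and]
    constructor
    · intro hx
      exact ⟨Units.mk0 _ (Algebra.norm_ne_zero_iff.2 hx), rfl⟩
    · rintro ⟨v, hv⟩ rfl
      rw [Algebra.norm_zero] at hv
      exact v.ne_zero hv.symm
  · intro v _ w _ hvw
    refine disjoint_left.2 fun x hv hw => hvw (Units.ext ?_)
    rw [← (mem_filter.1 hv).2, (mem_filter.1 hw).2]

theorem sum_norm_mul {M : Type*} [AddCommMonoid M] {b : K} {u v : Lˣ}
    (hb : Algebra.norm L b = u) (f : K → M) :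
    ∑ x : K with Algebra.norm L x = v, f (b * x) =
      ∑ x : K with Algebra.norm L x = ((u * v : Lˣ) : L), f x := by
  have hb0 : b ≠ 0 := by
    rintro rfl
    rw [Algebra.norm_zero] at hb
    exact u.ne_zero hb.symm
  refine sum_equiv (Equiv.mulLeft₀ b hb0) (fun x => ?_) fun x _ => rfl
  rw [mem_filter, mem_filter, Equiv.mulLeft₀_apply, map_mul, hb, Units.val_mul,
    mul_right_inj' u.ne_zero]
  simp

/-- The norm is surjective, so all its seven fibres over `Lˣ` have the same size. -/
theorem card_norm_eq (h8 : Nat.card L = 8) (u : Lˣ) :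
    (#{x : K | Algebra.norm L x = u} : ℝ) = ((Nat.card K : ℝ) - 1) / 7 := by
  have : Finite L := Nat.finite_of_card_ne_zero (by omega)
  have := Fintype.ofFinite Lˣ
  have hconst : ∀ v : Lˣ, ∑ x : K with Algebra.norm L x = v, (1 : ℝ) =
      ∑ x : K with Algebra.norm L x = u, (1 : ℝ) := by
    intro v
    obtain ⟨c, hc⟩ := FiniteField.norm_surjective L K ((u / v : Lˣ) : L)
    rw [sum_norm_mul hc (fun _ => (1 : ℝ)), div_mul_cancel]
  have htot := sum_eq_sum_norm_fibers (L := L) (fun _ : K => (1 : ℝ))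
  rw [sum_congr rfl fun v _ => hconst v] at htot
  simp only [sum_const, card_univ, nsmul_eq_mul, mul_one, ← Nat.card_eq_fintype_card,
    Nat.card_units, h8] at htot
  push_cast at htot
  linarith

theorem sum_eq_sum_norm_pow {g : Lˣ} (hg : (g : L) ^ 3 + g + 1 = 0) (h8 : Nat.card L = 8)
    (h2 : (2 : L) = 0) {M : Type*} [AddCommMonoid M] (f : K → M) :
    ∑ x, f x = f 0 + ∑ i ∈ range 7, ∑ x : K with Algebra.norm L x = g ^ i, f x := by
  have : Finite L := Nat.finite_of_card_ne_zero (by omega)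
  have := Fintype.ofFinite Lˣ
  rw [sum_eq_sum_norm_fibers (L := L), sum_units_eq hg h8 h2]
  simp only [Units.val_pow_eq_pow_val]

end Periods

/-! ### Weights of the codewords -/

section DefiningSet

variable {F L K : Type*} [Field F] [Field L] [Field K] [Fintype K]
  [Algebra F L] [Algebra L K] [Algebra F K] [IsScalarTower F L K]
  {g : Lˣ} (hg : (g : L) ^ 3 + g + 1 = 0)

include hg

omit [Algebra F K] [IsScalarTower F L K] in
/-- The exponents `0, 3, 5, 6` are those `i < 7` for which `g ^ i` has trace `1`. -/
theorem mem_definingSet_iff (hq : Nat.card F = 2) (hf : Module.finrank F L = 3) {a : F}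
    (ha : a ≠ 0) {x : K} {i : ℕ} (hi : i < 7) (hx : Algebra.norm L x = g ^ i) :
    x ∈ definingSet F L K a ↔ i ∈ ({0, 3, 5, 6} : Finset ℕ) := by
  obtain rfl := (eq_zero_or_one_of_card hq a).resolve_left ha
  have h2 := two_eq_zero_of_card hq
  have hx0 : x ≠ 0 := by
    rintro rfl
    rw [Algebra.norm_zero] at hx
    exact pow_ne_zero _ g.ne_zero hx.symm
  have hsign := signChar_trace_pow hg hq hf hi
  have hmem : x ∈ definingSet F L K 1 ↔ Algebra.trace F L (g ^ i) ≠ 0 := by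
    rw [definingSet, Set.mem_ofPred_eq, ← FiniteField.algebraMap_norm_eq_pow, hx]
    constructor
    · rintro ⟨-, y, hy, hty⟩ h0
      rw [(algebraMap L K).injective hy, h0, zero_add] at hty
      exact one_ne_zero hty
    · intro h
      refine ⟨hx0, _, rfl, ?_⟩
      rw [(eq_zero_or_one_of_card hq _).resolve_left h, one_add_one_eq_two, h2]
  rw [hmem]
  rw [signChar_apply] at hsign
  by_cases h : i ∈ ({1, 2, 4} : Finset ℕ)
  · rw [if_pos h] at hsign
    have h0 : Algebra.trace F L (g ^ i) = 0 := by
      by_contra h0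
      rw [if_neg h0] at hsign
      norm_num at hsign
    simp only [h0, ne_eq, not_true_eq_false, false_iff]
    simp only [mem_insert, mem_singleton] at h ⊢
    omega
  · rw [if_neg h] at hsign
    have h0 : Algebra.trace F L (g ^ i) ≠ 0 := by
      intro h0
      rw [if_pos h0] at hsign
      norm_num at hsign
    simp only [h0, ne_eq, not_false_eq_true, true_iff]
    simp only [mem_insert, mem_singleton] at h ⊢
    omega

omit [Algebra F K] [IsScalarTower F L K] in
/-- `D` is the union of the four fibres of the norm over the elements of trace `1`. -/
theorem sum_definingSet (hq : Nat.card F = 2) (hf : Module.finrank F L = 3) {a : F}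
    (ha : a ≠ 0) {n : ℕ} (d : Fin n ≃ definingSet F L K a) {M : Type*} [AddCommMonoid M]
    (f : K → M) :
    ∑ i, f (d i) =
      ∑ t ∈ ({0, 3, 5, 6} : Finset ℕ), ∑ x : K with Algebra.norm L x = g ^ t, f x := by
  have h1 : ∑ i, f (d i) = ∑ x : K, if x ∈ definingSet F L K a then f x else 0 := by
    rw [Equiv.sum_comp d (fun x => f x), ← sum_filter]
    exact (sum_subtype _ (by simp) f).symm
  rw [h1, sum_eq_sum_norm_pow hg (card_eq_eight hq hf) (two_eq_zero_of_algebra hq),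
    if_neg (fun h => h.1 rfl), zero_add]
  symm
  rw [← filter_mem_eq_inter.trans (inter_eq_right.2 (by decide : {0, 3, 5, 6} ⊆ range 7)),
    sum_filter]
  refine sum_congr rfl fun i hi => ?_
  have hiff := fun x (hx : x ∈ ({x : K | Algebra.norm L x = g ^ i} : Finset K)) =>
    mem_definingSet_iff hg hq hf ha (mem_range.1 hi) (mem_filter.1 hx).2
  by_cases h : i ∈ ({0, 3, 5, 6} : Finset ℕ)
  · rw [if_pos h]
    exact sum_congr rfl fun x hx => (if_pos ((hiff x hx).2 h)).symm
  · rw [if_neg h]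
    exact (sum_eq_zero fun x hx => if_neg (mt (hiff x hx).1 h)).symm

omit [Algebra F K] [IsScalarTower F L K] in
theorem length_eq (hq : Nat.card F = 2) (hf : Module.finrank F L = 3) {a : F}
    (ha : a ≠ 0) {n : ℕ} (d : Fin n ≃ definingSet F L K a) :
    (n : ℝ) = 4 * (Nat.card K - 1) / 7 := by
  have := sum_definingSet hg hq hf ha d (fun _ => (1 : ℝ))
  simp only [← Units.val_pow_eq_pow_val, sum_const, nsmul_eq_mul, mul_one, card_univ,
    Fintype.card_fin, card_norm_eq (card_eq_eight (L := L) hq hf)] at this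
  rw [this]
  simp
  ring

/-- The weight of the codeword of an element of norm `g ^ j`, where `q = |K|` and `m = [K : L]`. -/
def weightValue (q : ℝ) (m j : ℕ) : ℝ :=
  (4 * (q - 1) / 7 - ∑ t ∈ ({0, 3, 5, 6} : Finset ℕ), period m ((j + t) % 7)) / 2

/-- The weight of the codeword of `b` counts the `x ∈ D` with `Tr(b x) = 1`; multiplication by `b`
carries the fibre of the norm over `g ^ t` to the fibre over `g ^ (j + t)`. -/
theorem hammingNorm_eq (hq : Nat.card F = 2) (hf : Module.finrank F L = 3) {a : F}
    (ha : a ≠ 0) {n : ℕ} (d : Fin n ≃ definingSet F L K a) {b : K} {j : ℕ}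
    (hb : Algebra.norm L b = g ^ j) :
    (hammingNorm (fun i => Algebra.trace F K (b * d i)) : ℝ) =
      weightValue (Nat.card K) (Module.finrank L K) j := by
  have h2 := two_eq_zero_of_algebra (L := L) hq
  have hind : ∀ y : F, (if y ≠ 0 then (1 : ℝ) else 0) = (1 - signChar hq y) / 2 := by
    intro y
    simp only [signChar_apply, ne_eq, ite_not]
    split_ifs <;> norm_num
  have h1 : (hammingNorm (fun i => Algebra.trace F K (b * d i)) : ℝ) =
      ∑ i, (1 - signChar hq (Algebra.trace F K (b * d i))) / 2 := by
    rw [hammingNorm, card_filter]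
    push_cast
    exact sum_congr rfl fun i _ => hind _
  rw [h1, ← sum_div, sum_sub_distrib, weightValue, ← length_eq hg hq hf ha d,
    sum_definingSet hg hq hf ha d fun x => signChar hq (Algebra.trace F K (b * x))]
  congr 2
  · simp
  · refine sum_congr rfl fun t _ => ?_
    rw [← sum_norm_eq_pow (F := F) (K := K) hg hq hf (Nat.mod_lt (j + t) (by norm_num)),
      ← Units.val_pow_eq_pow_val, sum_norm_mul (u := g ^ j) (by simpa using hb)
        (fun x => signChar hq (Algebra.trace F K x)), ← pow_add, ← pow_mod_orderOf,
      orderOf_eq_seven hg h2, Units.val_pow_eq_pow_val]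

end DefiningSet

/-! ### The three weights in terms of powers of `1 + √-7` -/

/-- The squared absolute value of `(1 + √-7) ^ m = X + Y √-7` is `X ^ 2 + 7 Y ^ 2`. -/
theorem normSq_pow (m : ℕ) :
    ((1 + (√7 : ℂ) * Complex.I) ^ m).re ^ 2 + 7 * (((1 + (√7 : ℂ) * Complex.I) ^ m).im / √7) ^ 2 =
      8 ^ m := by
  have h7 : √7 ^ 2 = 7 := Real.sq_sqrt (by norm_num)
  have h := map_pow Complex.normSq (1 + (√7 : ℂ) * Complex.I) m
  have h1 : Complex.normSq (1 + (√7 : ℂ) * Complex.I) = 8 := by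
    rw [Complex.normSq_apply]
    simp
    linarith
  rw [h1, Complex.normSq_apply] at h
  rw [div_pow, h7]
  linarith

theorem rePow_natCast (m : ℕ) : rePow m = ((1 + (√7 : ℂ) * Complex.I) ^ m).re := by
  rw [rePow, zpow_natCast]

theorem inv_one_add_sqrt : (1 + (√7 : ℂ) * Complex.I)⁻¹ = (1 - (√7 : ℂ) * Complex.I) / 8 := by
  have h7 : (√7 : ℂ) ^ 2 = 7 := by
    rw [← Complex.ofReal_pow, Real.sq_sqrt (by norm_num)]
    norm_num
  refine inv_eq_of_mul_eq_one_right ?_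
  linear_combination -(√7 : ℂ) ^ 2 / 8 * Complex.I_sq + h7 / 8

/-- Negative shifts of the exponent are absorbed by `(1 + √-7)⁻¹ = (1 - √-7) / 8`. -/
theorem rePow_sub_natCast (m e : ℕ) : rePow ((m : ℤ) - e) =
    ((1 + (√7 : ℂ) * Complex.I) ^ m * ((1 - (√7 : ℂ) * Complex.I) / 8) ^ e).re := by
  have h0 : 1 + (√7 : ℂ) * Complex.I ≠ 0 := by
    intro h
    simpa using congrArg Complex.re h
  rw [rePow, zpow_sub₀ h0, zpow_natCast, zpow_natCast, div_eq_mul_inv, ← inv_pow,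
    inv_one_add_sqrt]

theorem rePow_sub_one (m : ℕ) : rePow ((m : ℤ) - 1) =
    (((1 + (√7 : ℂ) * Complex.I) ^ m).re +
      7 * (((1 + (√7 : ℂ) * Complex.I) ^ m).im / √7)) / 8 := by
  have h7 : √7 * √7 = 7 := Real.mul_self_sqrt (by norm_num)
  have := rePow_sub_natCast m 1
  rw [Nat.cast_one] at this
  rw [this, pow_one, mul_div_assoc']
  generalize (1 + (√7 : ℂ) * Complex.I) ^ m = z
  simp
  field_simp
  linear_combination z.im * h7

theorem rePow_sub_two (m : ℕ) : rePow ((m : ℤ) - 2) =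
    (7 * (((1 + (√7 : ℂ) * Complex.I) ^ m).im / √7) -
      3 * ((1 + (√7 : ℂ) * Complex.I) ^ m).re) / 32 := by
  have h7 : √7 * √7 = 7 := Real.mul_self_sqrt (by norm_num)
  have := rePow_sub_natCast m 2
  rw [Nat.cast_two] at this
  rw [this, pow_two]
  generalize (1 + (√7 : ℂ) * Complex.I) ^ m = z
  simp [Complex.mul_re, Complex.mul_im]
  field_simp
  linear_combination (64 * z.im - 32 * √7 * z.re) * h7

theorem weightValue_eq (q : ℝ) (m : ℕ) {j : ℕ} (hj : j < 7) : weightValue q m j =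
    if j = 0 then 2 * q / 7 + 12 / 7 * rePow ((m : ℤ) - 1)
    else if j ∈ ({1, 2, 4} : Finset ℕ) then 2 * q / 7 - 16 / 7 * rePow ((m : ℤ) - 2)
    else 2 * q / 7 - 2 / 7 * rePow m := by
  rw [rePow_sub_one, rePow_sub_two, rePow_natCast]
  interval_cases j <;> simp [weightValue, period] <;> ring

/-- By Cauchy–Schwarz, `(X + 7 Y) ^ 2 ≤ 8 (X ^ 2 + 7 Y ^ 2)` and
`(3 X - 7 Y) ^ 2 ≤ 16 (X ^ 2 + 7 Y ^ 2)`, and `X ^ 2 + 7 Y ^ 2 = q ≥ 8`. -/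
theorem weightValue_pos {q : ℝ} {m : ℕ} (hm : m ≠ 0) (hq : q = 8 ^ m) {j : ℕ} (hj : j < 7) :
    0 < weightValue q m j := by
  have h8 : 8 ≤ q := by
    rw [hq]
    exact le_self_pow₀ (by norm_num) hm
  have hn := normSq_pow m
  rw [← hq] at hn
  rw [weightValue_eq q m hj, rePow_sub_one, rePow_sub_two, rePow_natCast]
  generalize ((1 + (√7 : ℂ) * Complex.I) ^ m).re = x at *
  generalize ((1 + (√7 : ℂ) * Complex.I) ^ m).im / √7 = y at *
  split_ifs
  · have : |3 * (x + 7 * y)| < 4 * q :=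
      abs_lt_of_sq_lt_sq (by nlinarith [sq_nonneg (x - y)]) (by linarith)
    linarith [(abs_lt.1 this).1]
  · have : |3 * x - 7 * y| < 4 * q :=
      abs_lt_of_sq_lt_sq (by nlinarith [sq_nonneg (x + 3 * y)]) (by linarith)
    linarith [(abs_lt.1 this).1]
  · have : |x| < q := abs_lt_of_sq_lt_sq (by nlinarith [sq_nonneg y]) (by linarith)
    linarith [(abs_lt.1 this).2]

end TraceCode

end

/-! ### The weight distribution -/

theorem theorem3 {F L K : Type*} [Field F] [Field L] [Field K] [Finite K]
    [Algebra F L] [Algebra L K] [Algebra F K] [IsScalarTower F L K]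
    (k : ℕ) (hq : Nat.card F = 2) (hf : Module.finrank F L = 3) (hk : Module.finrank F K = k)
    (h3 : 3 ∣ k) (a : F) (ha : a ≠ 0)
    (n : ℕ) (d : Fin n ≃ TraceCode.definingSet F L K a) :
    let C : Submodule F (Fin n → F) := TraceCode.code F (fun i => (d i : K))
    let w₁ : ℝ := 2 ^ (k + 1) / 7 + 12 / 7 * TraceCode.rePow ((k : ℤ) / 3 - 1)
    let w₂ : ℝ := 2 ^ (k + 1) / 7 - 16 / 7 * TraceCode.rePow ((k : ℤ) / 3 - 2)
    let w₃ : ℝ := 2 ^ (k + 1) / 7 - 2 / 7 * TraceCode.rePow ((k : ℤ) / 3)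
    (n : ℝ) = 4 * (2 ^ k - 1) / 7 ∧
    Module.finrank F C = k ∧
    (TraceCode.nonzeroWeights C).card ≤ 3 ∧
    ∀ w : ℕ, (TraceCode.weightCount C w : ℝ) =
      (if w = 0 then 1 else 0)
      + (if (w : ℝ) = w₁ then ((2 : ℝ) ^ k - 1) / 7 else 0)
      + (if (w : ℝ) = w₂ then 3 * ((2 : ℝ) ^ k - 1) / 7 else 0)
      + (if (w : ℝ) = w₃ then 3 * ((2 : ℝ) ^ k - 1) / 7 else 0) := by
  intro C w₁ w₂ w₃
  classical
  have := Fintype.ofFinite K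
  have h8 := TraceCode.card_eq_eight (L := L) hq hf
  have h2 := TraceCode.two_eq_zero_of_algebra (L := L) hq
  have : Finite F := Nat.finite_of_card_ne_zero (by omega)
  have : Module.Finite F L := Module.finite_of_finrank_pos (by omega)
  obtain ⟨g, hg⟩ := TraceCode.exists_root_cubic h8 h2
  set m := Module.finrank L K with hm
  have hm0 : m ≠ 0 := Module.finrank_pos.ne'
  have hkm : k = 3 * m := by rw [← hk, ← Module.finrank_mul_finrank F L K, hf]
  have hdiv : (k : ℤ) / 3 = m := by
    rw [hkm]
    push_cast
    exact Int.mul_ediv_cancel_left _ (by norm_num)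
  have hcard : (Nat.card K : ℝ) = 2 ^ k := by
    rw [Module.natCard_eq_pow_finrank (K := F), hq, hk]
    norm_num
  have hcard8 : (2 : ℝ) ^ k = 8 ^ m := by
    rw [hkm, pow_mul]
    norm_num
  have hval : ∀ j < 7, TraceCode.weightValue (Nat.card K) m j =
      if j = 0 then w₁ else if j ∈ ({1, 2, 4} : Finset ℕ) then w₂ else w₃ := by
    intro j hj
    rw [TraceCode.weightValue_eq _ _ hj, hcard]
    simp only [w₁, w₂, w₃, hdiv, pow_succ, mul_comm]
  set T : K →ₗ[F] (Fin n → F) :=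
    LinearMap.pi fun i => (Algebra.trace F K).comp (LinearMap.mulRight F (d i : K)) with hT
  have hTC : C = LinearMap.range T := rfl
  have hnorm : ∀ b : K, ∀ j : ℕ, Algebra.norm L b = g ^ j →
      (hammingNorm (T b) : ℝ) = TraceCode.weightValue (Nat.card K) m j :=
    fun b j hb => TraceCode.hammingNorm_eq hg hq hf ha d hb
  -- a nonzero `b` has norm `g ^ j` for some `j`, hence a codeword of positive weight
  have hinj : Function.Injective T := by
    rw [injective_iff_map_eq_zero]
    intro b hb
    by_contra hb0
    obtain ⟨j, hj, hgj⟩ := TraceCode.exists_pow_eq hg h8 h2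
      (Units.mk0 _ (Algebra.norm_ne_zero_iff.2 hb0))
    have h := hnorm b j (by simpa using (congrArg Units.val hgj).symm)
    rw [hb, hammingNorm_zero, Nat.cast_zero] at h
    exact (TraceCode.weightValue_pos hm0 (hcard.trans hcard8) hj).ne h
  have hcount : ∀ w : ℕ, (TraceCode.weightCount C w : ℝ) =
      (if w = 0 then 1 else 0)
      + (if (w : ℝ) = w₁ then ((2 : ℝ) ^ k - 1) / 7 else 0)
      + (if (w : ℝ) = w₂ then 3 * ((2 : ℝ) ^ k - 1) / 7 else 0)
      + (if (w : ℝ) = w₃ then 3 * ((2 : ℝ) ^ k - 1) / 7 else 0) := by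
    intro w
    have h1 : TraceCode.weightCount C w = ∑ b : K, if hammingNorm (T b) = w then 1 else 0 := by
      rw [← Finset.card_filter, TraceCode.weightCount, ← Set.ncard_coe_finset,
        ← Set.ncard_image_of_injective _ hinj]
      congr 1
      ext c
      simp only [hTC, Set.mem_ofPred_eq, LinearMap.mem_range, Set.mem_image, Finset.coe_filter,
        Finset.mem_univ, true_and]
      constructor
      · rintro ⟨⟨b, rfl⟩, h⟩
        exact ⟨b, h, rfl⟩
      · rintro ⟨b, h, rfl⟩
        exact ⟨⟨b, rfl⟩, h⟩
    -- the weight is constant on each fibre of the norm, which has `(2 ^ k - 1) / 7` elements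
    have h4 : ∀ j ∈ Finset.range 7,
        (∑ b : K with Algebra.norm L b = g ^ j, if hammingNorm (T b) = w then (1 : ℝ) else 0) =
          if (w : ℝ) = (if j = 0 then w₁ else if j ∈ ({1, 2, 4} : Finset ℕ) then w₂ else w₃)
            then ((2 : ℝ) ^ k - 1) / 7 else 0 := by
      intro j hj
      have h5 : ∀ b ∈ ({b : K | Algebra.norm L b = g ^ j} : Finset K),
          (if hammingNorm (T b) = w then (1 : ℝ) else 0) =
          if (w : ℝ) = (if j = 0 then w₁ else if j ∈ ({1, 2, 4} : Finset ℕ) then w₂ else w₃)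
            then 1 else 0 := by
        intro b hb
        refine if_congr ?_ rfl rfl
        rw [← hval j (Finset.mem_range.1 hj), ← hnorm b j (Finset.mem_filter.1 hb).2, Nat.cast_inj,
          eq_comm]
      rw [Finset.sum_congr rfl h5, Finset.sum_const, nsmul_eq_mul, ← Units.val_pow_eq_pow_val,
        TraceCode.card_norm_eq h8, hcard, mul_ite, mul_one, mul_zero]
    rw [h1]
    push_cast
    rw [TraceCode.sum_eq_sum_norm_pow hg h8 h2, Finset.sum_congr rfl h4, map_zero,
      hammingNorm_zero]
    simp only [Finset.sum_range_succ, Finset.sum_range_zero, @eq_comm _ 0 w]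
    simp
    split_ifs <;> ring
  refine ⟨?_, ?_, ?_, hcount⟩
  · rw [TraceCode.length_eq hg hq hf ha d, hcard]
  · rw [hTC, LinearMap.finrank_range_of_inj hinj, hk]
  · refine (Finset.card_le_card_of_injOn (t := {w₁, w₂, w₃}) (fun w : ℕ => (w : ℝ)) ?_
      Nat.cast_injective.injOn).trans Finset.card_le_three
    intro w hw
    simp only [TraceCode.nonzeroWeights, Finset.coe_filter, Set.mem_ofPred_eq,
      Finset.mem_Icc] at hw
    by_contra h
    simp only [Finset.coe_insert, Finset.coe_singleton, Set.mem_insert_iff,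
      Set.mem_singleton_iff, not_or] at h
    have hw' := hcount w
    rw [if_neg (by omega), if_neg h.1, if_neg h.2.1, if_neg h.2.2] at hw'
    norm_num at hw'
    exact hw.2 hw'
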